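/- Angles are in radians. Let $0<\alpha<\pi/4$ (that is, $0^\circ<\alpha<45^\circ$) be such that $k=\pi/\alpha$ is an integer, and let $S$ be a finite set of $n$ points in the plane. **Definitions.** For a non-degenerate triangle $ABC$ and a point $q$, let $W_{q,a}=\{q+s(B-A)+t(C-A): s,t\ge 0\}$. The $a$-nearest neighbour of $q\in S$ is the first point of $(S\setminus\{q\})\cap W_{q,a}$ (if there is one) that is hit when a line parallel to $BC$, starting at $q$, sweeps over $W_{q,a}$; among several points hit first, the most clockwise one as seen from $q$ is taken. The $b$- and $c$-nearest neighbours are defined in the same way at the corners $B$ and $C$. The *3-sweep graph* of $S$ for $ABC$ joins every $q\in S$ to its $a$-, $b$- and $c$-nearest neighbours. Let $\Delta_1$ be a triangle $ABC$ with $A,B,C$ in clockwise order, with angles $2\alpha,\ \pi/2-\alpha,\ \pi/2-\alpha$ at $A,B,C$, and such that the vertically upward ray from $A$ bisects the angle at $A$. For $1\le i\le k$ let $\Delta_i$ be $\Delta_1$ rotated clockwise about $A$ by $\frac{i-1}{k}2\pi$, and let $G_i$ be the 3-sweep graph of $S$ for $\Delta_i$. The *$k$-layer 3-sweep graph* is $H_k=G_1\cup\dots\cup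 G_k$. A graph on $S$ is *angle-monotone of width $\gamma$* if every two vertices $s,t$ are joined by a path from $s$ to $t$ such that the vectors of all its edges, directed from $s$ to $t$ along the path, lie in a common wedge of angle $\gamma$. The *(full) $\Theta_6$-graph* of $S$ joins every $q\in S$, for each of the six closed cones with apex $q$ and direction angles in $[j\pi/3,(j+1)\pi/3]$, $0\le j\le 5$, to the point of $S\setminus\{q\}$ in the cone whose orthogonal projection to the bisector of the cone is closest to $q$ (if the cone contains such points), ties being broken by taking the most clockwise point. **Theorem.** There is an absolute constant $c>0$ such that for all $\alpha$, $k$, $S$ as above: 1. $H_k$ is angle-monotone of width $\pi/2+\alpha$ and has at most $c\,n/\alpha$ edges; 2. the same holds, with the same $c$, for every graph obtained by the construction of $H_k$ when ties among the points hit first are broken arbitrarily; 3. if $\alpha=\pi/6$ (so $k=6$), then $H_k$ is the full $\Theta_6$-graph of $S$. -/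

import Mathlib

noncomputable section

/-- The Euclidean plane. -/
abbrev Plane : Type := EuclideanSpace ℝ (Fin 2)

/-- The unit vector that makes the counterclockwise angle `θ` (radians) with the positive x-axis. -/
def dir (θ : ℝ) : Plane := !₂[Real.cos θ, Real.sin θ]

/-- The planar cross product; for vectors spanning less than a half-turn it is positive exactly
when `v` is counterclockwise of `u`. -/
def cross (u v : Plane) : ℝ := u 0 * v 1 - u 1 * v 0

/-- `v` lies in the (closed) wedge of angle `γ` at the origin, whose directions are the angles
in `[φ, φ + γ]`. -/
def InWedge (φ γ : ℝ) (v : Plane) : Prop :=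
  ∃ r ψ : ℝ, 0 ≤ r ∧ φ ≤ ψ ∧ ψ ≤ φ + γ ∧ v = r • dir ψ

/-- A walk (read from `s` to `t`) is angle-monotone of width `γ` if some wedge of angle `γ`
contains the vectors of all its edges. -/
def IsAngleMonotoneWalk {S : Finset Plane} {G : SimpleGraph S} (γ : ℝ) {s t : S}
    (w : G.Walk s t) : Prop :=
  ∃ φ : ℝ, ∀ d ∈ w.darts, InWedge φ γ ((d.snd : Plane) - (d.fst : Plane))

/-- A geometric graph on `S` is angle-monotone of width `γ` if every two vertices are joined by
an angle-monotone path of width `γ`. -/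
def IsAngleMonotone {S : Finset Plane} (γ : ℝ) (G : SimpleGraph S) : Prop :=
  ∀ s t : S, ∃ w : G.Walk s t, w.IsPath ∧ IsAngleMonotoneWalk γ w

/-- The wedge of `q` at the corner `A` of the triangle `A B C`: apex `q`, sides parallel to
`AB` and `AC`. -/
def wedge (A B C q : Plane) : Set Plane :=
  {p | ∃ s t : ℝ, 0 ≤ s ∧ 0 ≤ t ∧ p = q + s • (B - A) + t • (C - A)}

/-- The sweep line of the wedge of `q` at the corner `A`: parallel to `BC`, at time `l`.
At time `0` it passes through `q`, and it moves across the wedge as `l` grows. -/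
def sweepLine (A B C q : Plane) (l : ℝ) : Set Plane :=
  {p | ∃ t : ℝ, p = q + l • (B - A) + t • (C - B)}

/-- For the corner `T j` of the triangle `T 0, T 1, T 2`: among the points of `S` other than `q`
in the wedge of `q` at that corner, `p` is one of those that the sweep line hits first. -/
def IsNearest (S : Finset Plane) (T : Fin 3 → Plane) (j : Fin 3) (q p : S) : Prop :=
  p ≠ q ∧ (p : Plane) ∈ wedge (T j) (T (j + 1)) (T (j + 2)) q ∧
    ∃ l : ℝ, (p : Plane) ∈ sweepLine (T j) (T (j + 1)) (T (j + 2)) q l ∧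
      ∀ r : S, r ≠ q → (r : Plane) ∈ wedge (T j) (T (j + 1)) (T (j + 2)) q →
        ∀ m : ℝ, (r : Plane) ∈ sweepLine (T j) (T (j + 1)) (T (j + 2)) q m → l ≤ m

/-- Ties broken clockwise: `p` is the most clockwise point, as seen from `q`, among the points
related to `q` by `N`. -/
def MostClockwise {S : Finset Plane} (N : S → S → Prop) (q p : S) : Prop :=
  N q p ∧ ∀ r : S, N q r → r ≠ p →
    0 < cross ((p : Plane) - (q : Plane)) ((r : Plane) - (q : Plane))

/-- Ties broken arbitrarily: `R` keeps exactly one of the points related to `q` by `N`, for each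
`q` that has any. -/
def IsTieBreak {S : Finset Plane} (N R : S → S → Prop) : Prop :=
  (∀ q p, R q p → N q p) ∧ ∀ q, (∃ p, N q p) → ∃! p, R q p

/-- The 3-sweep graph of `S` for the triangle `T`, ties broken clockwise: every point is joined
to its nearest neighbours for the three corners. -/
def threeSweepGraph (S : Finset Plane) (T : Fin 3 → Plane) : SimpleGraph S :=
  SimpleGraph.fromRel fun q p => ∃ j : Fin 3, MostClockwise (IsNearest S T j) q p

/-- `G` is a 3-sweep graph of `S` for the triangle `T`, with some way of breaking ties. -/
def IsThreeSweepGraph (S : Finset Plane) (T : Fin 3 → Plane) (G : SimpleGraph S) : Prop :=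
  ∃ R : Fin 3 → S → S → Prop, (∀ j, IsTieBreak (IsNearest S T j) (R j)) ∧
    G = SimpleGraph.fromRel fun q p => ∃ j : Fin 3, R j q p

/-- The triangle `A B C` (in clockwise order) with `A` at the origin, angle `2 * α` at `A`, equal
sides `AB` and `AC`, and upward bisector at `A`, rotated clockwise about `A` by `θ`. -/
def rotatedTriangle (α θ : ℝ) : Fin 3 → Plane :=
  ![0, dir (Real.pi / 2 + α - θ), dir (Real.pi / 2 - α - θ)]

/-- The triangle of the `i`-th layer, `i = 0, …, k - 1`: rotated clockwise by `i / k` of a full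
turn. -/
def layerTriangle (α : ℝ) (k : ℕ) (i : Fin k) : Fin 3 → Plane :=
  rotatedTriangle α ((i : ℕ) / (k : ℝ) * (2 * Real.pi))

/-- The `k`-layer 3-sweep graph of `S` with respect to `α`, ties broken clockwise. -/
def layeredSweepGraph (S : Finset Plane) (α : ℝ) (k : ℕ) : SimpleGraph S :=
  ⨆ i : Fin k, threeSweepGraph S (layerTriangle α k i)

/-- `H` is a `k`-layer 3-sweep graph of `S` with respect to `α`, with some way of breaking the
ties in each layer. -/
def IsLayeredSweepGraph (S : Finset Plane) (α : ℝ) (k : ℕ) (H : SimpleGraph S) : Prop :=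
  ∃ G : Fin k → SimpleGraph S, (∀ i, IsThreeSweepGraph S (layerTriangle α k i) (G i)) ∧
    H = ⨆ i, G i

/-- Among the points of `S` other than `q` in the `j`-th of the six cones of angle `π / 3` with
apex `q`, `p` is one of those whose projection to the bisector of the cone is closest to `q`. -/
def IsThetaNearest (S : Finset Plane) (j : Fin 6) (q p : S) : Prop :=
  p ≠ q ∧ InWedge ((j : ℕ) * (Real.pi / 3)) (Real.pi / 3) ((p : Plane) - (q : Plane)) ∧
    ∀ r : S, r ≠ q →
      InWedge ((j : ℕ) * (Real.pi / 3)) (Real.pi / 3) ((r : Plane) - (q : Plane)) →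
        inner ℝ ((p : Plane) - (q : Plane)) (dir ((j : ℕ) * (Real.pi / 3) + Real.pi / 6)) ≤
          inner ℝ ((r : Plane) - (q : Plane)) (dir ((j : ℕ) * (Real.pi / 3) + Real.pi / 6))

/-- The (full) Θ₆-graph of `S`, ties broken clockwise. -/
def thetaSixGraph (S : Finset Plane) : SimpleGraph S :=
  SimpleGraph.fromRel fun q p => ∃ j : Fin 6, MostClockwise (IsThetaNearest S j) q p

end

/-!
A 3-sweep graph is governed by the barycentric coordinates of its triangle `A B C`. If `t` lies in
the wedge of `s` at `A`, follow `a`-nearest neighbours from `s` until one of them passes `t` in its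
`B`- or `C`-coordinate, say in the `B`-coordinate. That neighbour then lies in the wedge of `t` at
the corner `C`, and stepping from `t` to its `c`-nearest neighbour yields the same situation with
the two ends exchanged and fewer points in the parallelogram between them; so the two ends
eventually meet. Along the resulting path the `A`-coordinate decreases and the `C`-coordinate
increases, which confines the edges to a wedge bounded by the directions of `BC` and `AB`, of angle
`π / 2 + α`.

The wedges at the apices of the `k` layers cover all directions because `k * (2 * α) = 2 * π`, and
each layer has at most three edges per point. For `α = π / 6` the triangles are equilateral, their
wedges are exactly the cones of the Θ₆-graph, and the sweep line is perpendicular to the bisector.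
-/

open Real

section Selectors

variable {V : Type*} {f g x y z : V → ℝ} {R Ra Rb Rc : V → V → Prop}

/-- `R` selects nearest neighbours in quadrants: it relates each `q` only to points other than `q`
of the quadrant `{r | f q ≤ f r ∧ g q ≤ g r}` of `q` at which `f + g` is least, and to at least one
such point if the quadrant contains a point other than `q`. -/
structure IsQuadrantSelector (f g : V → ℝ) (R : V → V → Prop) : Prop where
  ne {q p : V} : R q p → p ≠ q
  le_left {q p : V} : R q p → f q ≤ f p
  le_right {q p : V} : R q p → g q ≤ g p
  add_le_add {q p r : V} : R q p → r ≠ q → f q ≤ f r → g q ≤ g r → f p + g p ≤ f r + g r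
  exists_rel {q r : V} : r ≠ q → f q ≤ f r → g q ≤ g r → ∃ p, R q p

lemma IsQuadrantSelector.symm (h : IsQuadrantSelector f g R) : IsQuadrantSelector g f R where
  ne := h.ne
  le_left := h.le_right
  le_right := h.le_left
  add_le_add hqp hr hg hf := by linarith [h.add_le_add hqp hr hf hg]
  exists_rel hr hg hf := h.exists_rel hr hf hg

/-- Triangular coordinates on a type of points: three real functions with sum zero, any two of
which separate the points. They abstract the barycentric coordinates of a triangle, up to additive
constants. -/
structure IsTriangularCoordinates (x y z : V → ℝ) : Prop where
  add_add_eq_zero (p : V) : x p + y p + z p = 0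
  eq_of_eq_of_eq {p q : V} : x p = x q → y p = y q → p = q

namespace IsTriangularCoordinates

lemma swap_left (h : IsTriangularCoordinates x y z) : IsTriangularCoordinates y x z where
  add_add_eq_zero p := by linarith [h.add_add_eq_zero p]
  eq_of_eq_of_eq hy hx := h.eq_of_eq_of_eq hx hy

lemma swap_right (h : IsTriangularCoordinates x y z) : IsTriangularCoordinates x z y where
  add_add_eq_zero p := by linarith [h.add_add_eq_zero p]
  eq_of_eq_of_eq {p q} hx hz :=
    h.eq_of_eq_of_eq hx (by linarith [h.add_add_eq_zero p, h.add_add_eq_zero q])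

lemma lt_of_le_of_le (h : IsTriangularCoordinates x y z) {p q : V} (hx : x q ≤ x p)
    (hy : y q ≤ y p) (hne : p ≠ q) : z p < z q := by
  by_contra! hz
  have hp := h.add_add_eq_zero p
  have hq := h.add_add_eq_zero q
  exact hne (h.eq_of_eq_of_eq (by linarith) (by linarith))

end IsTriangularCoordinates

lemma IsTriangularCoordinates.le_and_le_of_rel_or_rel (hxyz : IsTriangularCoordinates x y z)
    (ha : IsQuadrantSelector x y Ra) (hc : IsQuadrantSelector z x Rc) {p q : V}
    (hpq : Ra p q ∨ Rc q p) : z q ≤ z p ∧ y p ≤ y q := by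
  have hsum := hxyz.add_add_eq_zero
  rcases hpq with h | h
  · exact ⟨by linarith [hsum p, hsum q, ha.le_left h, ha.le_right h], ha.le_right h⟩
  · exact ⟨hc.le_left h, by linarith [hsum p, hsum q, hc.le_left h, hc.le_right h]⟩

/-- If the selected neighbour `s` of `s₀` lies beyond `t`, then `s` is in turn visible from `t`, and
a chain zigzagging between the two corners closes the gap from both ends. The chain from `t` has
the same shape with the roles of `y` and `z` exchanged. -/
theorem reflTransGen_of_overshoot [Finite V] (hxyz : IsTriangularCoordinates x y z)
    (ha : IsQuadrantSelector x y Ra) (hc : IsQuadrantSelector z x Rc) {s₀ s t : V}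
    (hs : Ra s₀ s) (hx₀ : x s₀ ≤ x t) (hy₀ : y s₀ ≤ y t) (hx : x t ≤ x s) :
    Relation.ReflTransGen (fun p q => Ra p q ∨ Rc q p) s₀ t := by
  induction hn : {r | y r ∈ Set.Icc (y s) (y t) ∧ z r ∈ Set.Icc (z t) (z s)}.ncard
    using Nat.strong_induction_on generalizing y z Ra Rc s₀ s t with
  | _ n ih =>
  subst hn
  obtain rfl | ht₀ := eq_or_ne t s₀
  · exact .refl
  obtain rfl | hst := eq_or_ne s t
  · exact .single (.inl hs)
  have hsum := hxyz.add_add_eq_zero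
  have hz : z t ≤ z s := by linarith [hsum s, hsum t, ha.add_le_add hs ht₀ hx₀ hy₀]
  obtain ⟨t₁, ht₁⟩ := hc.exists_rel hst hz hx
  have hzt₁ : z t ≤ z t₁ := hc.le_left ht₁
  have hxt₁ : x t ≤ x t₁ := hc.le_right ht₁
  have hyt₁ : y t₁ < y t := hxyz.swap_right.swap_left.lt_of_le_of_le hzt₁ hxt₁ (hc.ne ht₁)
  have hyst₁ : y s ≤ y t₁ := by linarith [hsum s, hsum t₁, hc.add_le_add ht₁ hst hz hx]
  have hlt : {r | y r ∈ Set.Icc (y s) (y t₁) ∧ z r ∈ Set.Icc (z t₁) (z s)}.ncard <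
      {r | y r ∈ Set.Icc (y s) (y t) ∧ z r ∈ Set.Icc (z t) (z s)}.ncard := by
    refine Set.ncard_lt_ncard ⟨fun r hr => ?_, fun hsub => ?_⟩
    · exact ⟨Set.Icc_subset_Icc_right hyt₁.le hr.1, Set.Icc_subset_Icc_left hzt₁ hr.2⟩
    · have ht : t ∈ {r | y r ∈ Set.Icc (y s) (y t) ∧ z r ∈ Set.Icc (z t) (z s)} :=
        ⟨⟨by linarith, le_rfl⟩, ⟨le_rfl, hz⟩⟩
      exact hyt₁.not_ge (hsub ht).1.2
  rcases le_total (x s) (x t₁) with hxs | hxs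
  · have hts := ih _ hlt hxyz.swap_right hc.symm ha.symm ht₁ hx hz hxs (by simp only [and_comm])
    refine .head (.inl hs) (Relation.reflTransGen_swap.1 ?_)
    simpa only [Function.swap, or_comm] using hts
  · exact (ih _ hlt hxyz ha hc hs (hx₀.trans hxt₁) ((ha.le_right hs).trans hyst₁) hxs rfl).tail
      (.inr ht₁)

theorem reflTransGen_of_mem_quadrant [Finite V] (hxyz : IsTriangularCoordinates x y z)
    (ha : IsQuadrantSelector x y Ra) (hb : IsQuadrantSelector y z Rb)
    (hc : IsQuadrantSelector z x Rc) {s t : V} (hx : x s ≤ x t) (hy : y s ≤ y t) :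
    Relation.ReflTransGen (fun p q => Ra p q ∨ Rc q p) s t ∨
      Relation.ReflTransGen (fun p q => Ra p q ∨ Rb q p) s t := by
  have hwf : WellFounded (z ⁻¹'o (· < ·)) := Finite.wellFounded_of_trans_of_irrefl _
  induction s using hwf.induction with
  | _ s ih =>
  obtain rfl | hts := eq_or_ne t s
  · exact .inl .refl
  obtain ⟨s₁, hs₁⟩ := ha.exists_rel hts hx hy
  rcases le_total (x t) (x s₁) with hxs | hxs
  · exact .inl (reflTransGen_of_overshoot hxyz ha hc hs₁ hx hy hxs)
  rcases le_total (y t) (y s₁) with hys | hys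
  · exact .inr (reflTransGen_of_overshoot hxyz.swap_left ha.symm hb.symm hs₁ hy hx hys)
  have hlt : z s₁ < z s := hxyz.lt_of_le_of_le (ha.le_left hs₁) (ha.le_right hs₁) (ha.ne hs₁)
  exact (ih s₁ hlt hxs hys).imp (.head (.inl hs₁)) (.head (.inl hs₁))

end Selectors

section Graphs

variable {V ι : Type*} {G : SimpleGraph V}

lemma exists_isPath_of_reflTransGen {E : V → V → Prop} (hE : ∀ p q, E p q → G.Adj p q) {s t : V}
    (hst : Relation.ReflTransGen E s t) :
    ∃ w : G.Walk s t, w.IsPath ∧ ∀ d ∈ w.darts, E d.fst d.snd := by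
  classical
  suffices h : ∃ w : G.Walk s t, ∀ d ∈ w.darts, E d.fst d.snd by
    obtain ⟨w, hw⟩ := h
    exact ⟨w.bypass, w.bypass_isPath, fun d hd => hw d (w.darts_bypass_subset_darts hd)⟩
  induction hst using Relation.ReflTransGen.head_induction_on with
  | refl => exact ⟨.nil, by simp⟩
  | head hpq _ ih =>
    obtain ⟨w, hw⟩ := ih
    refine ⟨.cons (hE _ _ hpq) w, ?_⟩
    simpa only [SimpleGraph.Walk.darts_cons, List.forall_mem_cons] using ⟨hpq, hw⟩

lemma ncard_edgeSet_le_of_rightUnique [Finite V] [Finite ι] {R : ι → V → V → Prop}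
    (hR : ∀ i, Relator.RightUnique (R i))
    (hG : ∀ p q, G.Adj p q → ∃ i, R i p q ∨ R i q p) :
    G.edgeSet.ncard ≤ Nat.card ι * Nat.card V := by
  set A : Set (ι × V × V) := {a | R a.1 a.2.1 a.2.2}
  have hsub : G.edgeSet ⊆ (fun a : ι × V × V => s(a.2.1, a.2.2)) '' A := by
    intro e
    induction e with
    | _ p q =>
      intro hpq
      obtain ⟨i, h | h⟩ := hG p q hpq
      · exact ⟨(i, p, q), h, rfl⟩
      · exact ⟨(i, q, p), h, Sym2.eq_swap⟩
  have hinj : Set.InjOn (fun a : ι × V × V => (a.1, a.2.1)) A := by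
    rintro ⟨i, q, p⟩ h ⟨i', q', p'⟩ h' heq
    obtain ⟨rfl, rfl⟩ := Prod.mk.inj heq
    obtain rfl : p = p' := hR i h h'
    rfl
  calc G.edgeSet.ncard
      ≤ ((fun a : ι × V × V => s(a.2.1, a.2.2)) '' A).ncard := Set.ncard_le_ncard hsub
    _ ≤ A.ncard := Set.ncard_image_le
    _ ≤ (Set.univ : Set (ι × V)).ncard :=
        Set.ncard_le_ncard_of_injOn _ (fun _ _ => Set.mem_univ _) hinj
    _ = Nat.card ι * Nat.card V := by rw [Set.ncard_univ, Nat.card_prod]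

end Graphs

section Plane

@[simp] lemma dir_zero_apply (θ : ℝ) : dir θ 0 = cos θ := rfl

@[simp] lemma dir_one_apply (θ : ℝ) : dir θ 1 = sin θ := rfl

lemma plane_ext {v w : Plane} (h₀ : v 0 = w 0) (h₁ : v 1 = w 1) : v = w :=
  PiLp.ext (Fin.forall_fin_two.2 ⟨h₀, h₁⟩)

lemma dir_add_pi (θ : ℝ) : dir (θ + π) = -dir θ :=
  plane_ext (cos_add_pi θ) (sin_add_pi θ)

lemma dir_sub_pi (θ : ℝ) : dir (θ - π) = -dir θ :=
  plane_ext (cos_sub_pi θ) (sin_sub_pi θ)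

lemma dir_add_int_mul_two_pi (θ : ℝ) (n : ℤ) : dir (θ + n * (2 * π)) = dir θ :=
  plane_ext (cos_add_int_mul_two_pi θ n) (sin_add_int_mul_two_pi θ n)

lemma dir_sub_dir_add (φ γ : ℝ) :
    dir φ - dir (φ + γ) = (2 * sin (γ / 2)) • dir (φ + γ / 2 - π / 2) := by
  have hmid : φ + γ / 2 - π / 2 = (φ + (φ + γ)) / 2 - π / 2 := by ring
  have hhalf : γ / 2 = -((φ - (φ + γ)) / 2) := by ring
  rw [hmid, hhalf, sin_neg]
  apply plane_ext
  · simp only [PiLp.sub_apply, PiLp.smul_apply, smul_eq_mul, dir_zero_apply, cos_sub_cos,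
      cos_sub_pi_div_two]
    ring
  · simp only [PiLp.sub_apply, PiLp.smul_apply, smul_eq_mul, dir_one_apply, sin_sub_sin,
      sin_sub_pi_div_two]
    ring

lemma exists_polar_Ioc (v : Plane) (a : ℝ) :
    ∃ r ψ : ℝ, 0 ≤ r ∧ ψ ∈ Set.Ioc a (a + 2 * π) ∧ v = r • dir ψ := by
  set c : ℂ := ⟨v 0, v 1⟩
  have hv : v = ‖c‖ • dir c.arg :=
    plane_ext (Complex.norm_mul_cos_arg c).symm (Complex.norm_mul_sin_arg c).symm
  refine ⟨‖c‖, toIocMod two_pi_pos a c.arg, norm_nonneg c, toIocMod_mem_Ioc _ a _, ?_⟩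
  rw [← dir_add_int_mul_two_pi _ (toIocDiv two_pi_pos a c.arg), ← zsmul_eq_mul,
    toIocMod_add_toIocDiv_zsmul, ← hv]

lemma cross_swap (v w : Plane) : cross v w = -cross w v := by
  simp only [cross]; ring

lemma cross_sub_right (u v w : Plane) : cross u (v - w) = cross u v - cross u w := by
  simp only [cross, PiLp.sub_apply]; ring

lemma cross_sub_comm (A B v : Plane) : cross v (B - A) = cross (A - B) v := by
  simp only [cross, PiLp.sub_apply]; ring

lemma cross_smul_left (r : ℝ) (v w : Plane) : cross (r • v) w = r * cross v w := by
  simp only [cross, PiLp.smul_apply, smul_eq_mul]; ring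

lemma cross_smul_right (r : ℝ) (v w : Plane) : cross v (r • w) = r * cross v w := by
  simp only [cross, PiLp.smul_apply, smul_eq_mul]; ring

lemma cross_sub_sub_rotate (A B C : Plane) : cross (C - B) (A - B) = cross (B - A) (C - A) := by
  simp only [cross, PiLp.sub_apply]; ring

lemma cross_dir_dir (θ ψ : ℝ) : cross (dir θ) (dir ψ) = sin (ψ - θ) := by
  simp only [cross, dir_zero_apply, dir_one_apply, sin_sub]; ring

lemma cross_dir_sub_pi_div_two (ψ : ℝ) (v : Plane) :
    cross (dir (ψ - π / 2)) v = inner ℝ v (dir ψ) := by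
  simp only [cross, PiLp.inner_apply, Fin.sum_univ_two, dir_zero_apply, dir_one_apply,
    cos_sub_pi_div_two, sin_sub_pi_div_two, RCLike.inner_apply, conj_trivial]
  ring

lemma inWedge_iff_cross_dir {φ γ : ℝ} (hγ₀ : 0 < γ) (hγπ : γ < π) (v : Plane) :
    InWedge φ γ v ↔ 0 ≤ cross (dir φ) v ∧ 0 ≤ cross v (dir (φ + γ)) := by
  constructor
  · rintro ⟨r, ψ, hr, hφψ, hψγ, rfl⟩
    rw [cross_smul_left, cross_smul_right, cross_dir_dir, cross_dir_dir]
    exact ⟨mul_nonneg hr (sin_nonneg_of_nonneg_of_le_pi (by linarith) (by linarith)),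
      mul_nonneg hr (sin_nonneg_of_nonneg_of_le_pi (by linarith) (by linarith))⟩
  · obtain ⟨r, ψ, hr, ⟨hψ₀, hψπ⟩, rfl⟩ := exists_polar_Ioc v (φ - π)
    rw [cross_smul_left, cross_smul_right, cross_dir_dir, cross_dir_dir]
    rintro ⟨hleft, hright⟩
    rcases hr.eq_or_lt with rfl | hr
    · exact ⟨0, φ, le_rfl, le_rfl, by linarith, by simp only [zero_smul]⟩
    replace hleft := nonneg_of_mul_nonneg_right hleft hr
    replace hright := nonneg_of_mul_nonneg_right hright hr
    refine ⟨r, ψ, hr.le, ?_, ?_, rfl⟩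
    · by_contra! hlt
      exact hleft.not_gt (sin_neg_of_neg_of_neg_pi_lt (by linarith) (by linarith))
    · by_contra! hlt
      exact hright.not_gt (sin_neg_of_neg_of_neg_pi_lt (by linarith) (by linarith))

lemma inWedge_iff_cross {φ γ a b : ℝ} {u w : Plane} (hγ₀ : 0 < γ) (hγπ : γ < π) (ha : 0 < a)
    (hb : 0 < b) (hu : u = a • dir φ) (hw : w = b • dir (φ + γ)) (v : Plane) :
    InWedge φ γ v ↔ 0 ≤ cross u v ∧ 0 ≤ cross v w := by
  rw [inWedge_iff_cross_dir hγ₀ hγπ, hu, hw, cross_smul_left, cross_smul_right,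
    mul_nonneg_iff_of_pos_left ha, mul_nonneg_iff_of_pos_left hb]

lemma inWedge_add_int_mul_two_pi {φ γ : ℝ} (n : ℤ) (v : Plane) :
    InWedge (φ + n * (2 * π)) γ v ↔ InWedge φ γ v := by
  constructor
  · rintro ⟨r, ψ, hr, hφψ, hψγ, rfl⟩
    refine ⟨r, ψ + (-n : ℤ) * (2 * π), hr, ?_, ?_, by rw [dir_add_int_mul_two_pi]⟩ <;>
      push_cast <;> linarith
  · rintro ⟨r, ψ, hr, hφψ, hψγ, rfl⟩
    exact ⟨r, ψ + n * (2 * π), hr, by linarith, by linarith, by rw [dir_add_int_mul_two_pi]⟩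

lemma exists_inWedge_of_two_pi_le {k : ℕ} {γ : ℝ} (hk : 2 * π ≤ k * γ) (φ : ℝ) (v : Plane) :
    ∃ i : Fin k, InWedge (φ - (i : ℕ) / (k : ℝ) * (2 * π)) γ v := by
  have hk₀ : (0 : ℝ) < k := by
    refine (Nat.cast_nonneg k).lt_of_ne fun h => ?_
    rw [← h, zero_mul] at hk
    exact two_pi_pos.not_ge hk
  set δ := 2 * π / k with hδ
  have hδ₀ : 0 < δ := div_pos two_pi_pos hk₀
  have hδγ : δ ≤ γ := (div_le_iff₀' hk₀).2 hk
  obtain ⟨r, ψ, hr, ⟨hψ₀, hψ₁⟩, rfl⟩ := exists_polar_Ioc v (φ + δ - 2 * π)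
  have hquot : 0 ≤ (φ + δ - ψ) / δ := div_nonneg (by linarith) hδ₀.le
  have hle := (le_div_iff₀ hδ₀).1 (Nat.floor_le hquot)
  have hlt := (div_lt_iff₀ hδ₀).1 (Nat.lt_floor_add_one ((φ + δ - ψ) / δ))
  have hik : ⌊(φ + δ - ψ) / δ⌋₊ < k := by
    rw [Nat.floor_lt hquot, div_lt_iff₀ hδ₀, hδ, mul_div_cancel₀ _ hk₀.ne']
    linarith
  refine ⟨⟨_, hik⟩, r, ψ, hr, ?_, ?_, rfl⟩ <;> rw [div_mul_eq_mul_div, mul_div_assoc, ← hδ] <;>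
    linarith

end Plane

section Triangles

variable {A B C : Plane}

/-- The linear part of the barycentric coordinate of the corner `A` in the triangle `A B C`: the
linear form that vanishes on the direction of `BC` and increases by `1` from `B` to `A`. The
coordinates of the corners `B` and `C` are obtained by rotating the arguments. -/
noncomputable def baryForm (A B C v : Plane) : ℝ := cross (C - B) v / cross (B - A) (C - A)

lemma baryForm_sub (A B C v w : Plane) :
    baryForm A B C (v - w) = baryForm A B C v - baryForm A B C w := by
  simp only [baryForm, cross_sub_right, sub_div]

lemma baryForm_add_add_eq_zero (A B C v : Plane) :
    baryForm B C A v + baryForm C A B v + baryForm A B C v = 0 := by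
  have hsum : cross (A - C) v + cross (B - A) v + cross (C - B) v = 0 := by
    simp only [cross, PiLp.sub_apply]; ring
  simp only [baryForm, cross_sub_sub_rotate B C A, cross_sub_sub_rotate A B C, ← add_div, hsum,
    zero_div]

lemma baryForm_smul_add_baryForm_smul (hABC : cross (B - A) (C - A) ≠ 0) (v : Plane) :
    baryForm B C A v • (B - A) + baryForm C A B v • (C - A) = v := by
  have hcramer : cross (A - C) v • (B - A) + cross (B - A) v • (C - A) =
      cross (B - A) (C - A) • v := by
    apply plane_ext <;>
      simp only [cross, PiLp.add_apply, PiLp.sub_apply, PiLp.smul_apply, smul_eq_mul] <;> ring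
  simp only [baryForm, cross_sub_sub_rotate B C A, cross_sub_sub_rotate A B C,
    div_eq_inv_mul, mul_smul, ← smul_add, hcramer, inv_smul_smul₀ hABC]

lemma mem_wedge_iff (hABC : cross (B - A) (C - A) ≠ 0) {p q : Plane} :
    p ∈ wedge A B C q ↔ 0 ≤ baryForm B C A (p - q) ∧ 0 ≤ baryForm C A B (p - q) := by
  constructor
  · rintro ⟨s, t, hs, ht, rfl⟩
    have hB : baryForm B C A (q + s • (B - A) + t • (C - A) - q) = s := by
      rw [baryForm, cross_sub_sub_rotate, div_eq_iff hABC]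
      simp only [cross, PiLp.sub_apply, PiLp.add_apply, PiLp.smul_apply, smul_eq_mul]; ring
    have hC : baryForm C A B (q + s • (B - A) + t • (C - A) - q) = t := by
      rw [baryForm, cross_sub_sub_rotate, cross_sub_sub_rotate, div_eq_iff hABC]
      simp only [cross, PiLp.sub_apply, PiLp.add_apply, PiLp.smul_apply, smul_eq_mul]; ring
    rw [hB, hC]
    exact ⟨hs, ht⟩
  · rintro ⟨hs, ht⟩
    refine ⟨_, _, hs, ht, ?_⟩
    rw [add_assoc, baryForm_smul_add_baryForm_smul hABC, add_sub_cancel]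

lemma mem_sweepLine_iff (hABC : cross (B - A) (C - A) ≠ 0) {p q : Plane} {l : ℝ} :
    p ∈ sweepLine A B C q l ↔ l = -baryForm A B C (p - q) := by
  constructor
  · rintro ⟨t, rfl⟩
    rw [baryForm, ← neg_div, eq_div_iff hABC]
    simp only [cross, PiLp.sub_apply, PiLp.add_apply, PiLp.smul_apply, smul_eq_mul]; ring
  · intro hl
    have hsum : l = baryForm B C A (p - q) + baryForm C A B (p - q) := by
      linarith [baryForm_add_add_eq_zero A B C (p - q)]
    refine ⟨baryForm C A B (p - q), ?_⟩
    calc p = q + (p - q) := (add_sub_cancel q p).symm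
      _ = q + (baryForm B C A (p - q) • (B - A) + baryForm C A B (p - q) • (C - A)) := by
        rw [baryForm_smul_add_baryForm_smul hABC]
      _ = q + l • (B - A) + baryForm C A B (p - q) • (C - B) := by rw [hsum]; module

lemma eq_of_baryForm_eq (hABC : cross (B - A) (C - A) ≠ 0) {p q : Plane}
    (hB : baryForm B C A p = baryForm B C A q) (hC : baryForm C A B p = baryForm C A B q) :
    p = q := by
  rw [← baryForm_smul_add_baryForm_smul hABC p, hB, hC, baryForm_smul_add_baryForm_smul hABC]

lemma isTriangularCoordinates_baryForm (S : Finset Plane) (hABC : cross (B - A) (C - A) ≠ 0) :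
    IsTriangularCoordinates (fun p : S => baryForm B C A p) (fun p : S => baryForm C A B p)
      (fun p : S => baryForm A B C p) where
  add_add_eq_zero p := baryForm_add_add_eq_zero A B C p
  eq_of_eq_of_eq hB hC := Subtype.ext (eq_of_baryForm_eq hABC hB hC)

lemma cross_eq_of_baryForm_eq (hABC : cross (B - A) (C - A) ≠ 0) {v w : Plane}
    (h : baryForm A B C v = baryForm A B C w) :
    cross v w = cross (B - A) (C - A) * baryForm A B C v *
      (baryForm B C A w - baryForm B C A v) := by
  have hC (u : Plane) : baryForm C A B u = -baryForm A B C u - baryForm B C A u := by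
    linarith [baryForm_add_add_eq_zero A B C u]
  calc cross v w
      = cross (baryForm B C A v • (B - A) + baryForm C A B v • (C - A))
          (baryForm B C A w • (B - A) + baryForm C A B w • (C - A)) := by
        rw [baryForm_smul_add_baryForm_smul hABC, baryForm_smul_add_baryForm_smul hABC]
    _ = cross (B - A) (C - A) *
          (baryForm B C A v * baryForm C A B w - baryForm C A B v * baryForm B C A w) := by
        simp only [cross, PiLp.add_apply, PiLp.sub_apply, PiLp.smul_apply, smul_eq_mul]; ring
    _ = _ := by rw [hC v, hC w, ← h]; ring

lemma baryForm_nonpos_iff (hABC : cross (B - A) (C - A) < 0) (v : Plane) :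
    baryForm A B C v ≤ 0 ↔ 0 ≤ cross (C - B) v := by
  rw [baryForm, div_le_iff_of_neg hABC, zero_mul]

lemma baryForm_nonneg_iff (hABC : cross (B - A) (C - A) < 0) (v : Plane) :
    0 ≤ baryForm A B C v ↔ 0 ≤ cross v (C - B) := by
  rw [baryForm, le_div_iff_of_neg hABC, zero_mul, cross_swap, neg_nonpos]

lemma cross_sub_sub_neg {φ γ a b : ℝ} (hγ₀ : 0 < γ) (hγπ : γ < π) (ha : 0 < a) (hb : 0 < b)
    (hC : C - A = a • dir φ) (hB : B - A = b • dir (φ + γ)) : cross (B - A) (C - A) < 0 := by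
  rw [hB, hC, cross_smul_left, cross_smul_right, cross_dir_dir, sub_add_cancel_left, sin_neg,
    mul_neg, mul_neg, neg_lt_zero]
  exact mul_pos hb (mul_pos ha (sin_pos_of_pos_of_lt_pi hγ₀ hγπ))

lemma mem_wedge_iff_inWedge {φ γ a b : ℝ} (hγ₀ : 0 < γ) (hγπ : γ < π) (ha : 0 < a) (hb : 0 < b)
    (hC : C - A = a • dir φ) (hB : B - A = b • dir (φ + γ)) {p q : Plane} :
    p ∈ wedge A B C q ↔ InWedge φ γ (p - q) := by
  have hABC := cross_sub_sub_neg hγ₀ hγπ ha hb hC hB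
  have hBCA : cross (C - B) (A - B) < 0 := by rwa [cross_sub_sub_rotate]
  have hCAB : cross (A - C) (B - C) < 0 := by rwa [cross_sub_sub_rotate]
  rw [mem_wedge_iff hABC.ne, inWedge_iff_cross hγ₀ hγπ ha hb hC hB, baryForm_nonneg_iff hBCA,
    baryForm_nonneg_iff hCAB, cross_sub_comm]

lemma baryForm_le_baryForm_iff_inner {φ γ a : ℝ} (hγ₀ : 0 < γ) (hγπ : γ < π) (ha : 0 < a)
    (hC : C - A = a • dir φ) (hB : B - A = a • dir (φ + γ)) (v w : Plane) :
    baryForm A B C v ≤ baryForm A B C w ↔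
      inner ℝ w (dir (φ + γ / 2)) ≤ inner ℝ v (dir (φ + γ / 2)) := by
  have hbase : C - B = (a * (2 * sin (γ / 2))) • dir (φ + γ / 2 - π / 2) := by
    rw [← sub_sub_sub_cancel_right C B A, hC, hB, ← smul_sub, dir_sub_dir_add, smul_smul]
  have hpos : 0 < a * (2 * sin (γ / 2)) :=
    mul_pos ha (mul_pos two_pos (sin_pos_of_pos_of_lt_pi (by linarith) (by linarith)))
  rw [baryForm, baryForm, div_le_div_right_of_neg (cross_sub_sub_neg hγ₀ hγπ ha ha hC hB), hbase,
    cross_smul_left, cross_smul_left, mul_le_mul_iff_right₀ hpos, cross_dir_sub_pi_div_two,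
    cross_dir_sub_pi_div_two]

end Triangles

section Nearest

variable {S : Finset Plane} {T : Fin 3 → Plane}

lemma cross_sides (T : Fin 3 → Plane) (j : Fin 3) :
    cross (T (j + 1) - T j) (T (j + 2) - T j) = cross (T 1 - T 0) (T 2 - T 0) := by
  fin_cases j
  · rfl
  · exact cross_sub_sub_rotate (T 0) (T 1) (T 2)
  · exact (cross_sub_sub_rotate (T 2) (T 0) (T 1)).symm

lemma isNearest_iff (hT : cross (T 1 - T 0) (T 2 - T 0) ≠ 0) {j : Fin 3} {q p : S} :
    IsNearest S T j q p ↔ p ≠ q ∧ (p : Plane) ∈ wedge (T j) (T (j + 1)) (T (j + 2)) q ∧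
      ∀ r : S, r ≠ q → (r : Plane) ∈ wedge (T j) (T (j + 1)) (T (j + 2)) q →
        baryForm (T j) (T (j + 1)) (T (j + 2)) (r - q) ≤
          baryForm (T j) (T (j + 1)) (T (j + 2)) (p - q) := by
  rw [← cross_sides T j] at hT
  simp only [IsNearest, mem_sweepLine_iff hT, exists_eq_left, forall_eq, neg_le_neg_iff]

lemma exists_isNearest (hT : cross (T 1 - T 0) (T 2 - T 0) ≠ 0) {j : Fin 3} {q r : S}
    (hr : r ≠ q) (hrq : (r : Plane) ∈ wedge (T j) (T (j + 1)) (T (j + 2)) q) :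
    ∃ p, IsNearest S T j q p := by
  obtain ⟨p, ⟨hp, hpq⟩, hmax⟩ :=
    Set.exists_max_image {p : S | p ≠ q ∧ (p : Plane) ∈ wedge (T j) (T (j + 1)) (T (j + 2)) q}
      (fun p => baryForm (T j) (T (j + 1)) (T (j + 2)) (p - q)) (Set.toFinite _) ⟨r, hr, hrq⟩
  exact ⟨p, (isNearest_iff hT).2 ⟨hp, hpq, fun r hr hrq => hmax r ⟨hr, hrq⟩⟩⟩

lemma IsTieBreak.isQuadrantSelector {R : S → S → Prop} {j : Fin 3}
    (hT : cross (T 1 - T 0) (T 2 - T 0) ≠ 0) (hR : IsTieBreak (IsNearest S T j) R) :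
    IsQuadrantSelector (fun p : S => baryForm (T (j + 1)) (T (j + 2)) (T j) p)
      (fun p : S => baryForm (T (j + 2)) (T j) (T (j + 1)) p) R := by
  have hwedge (p q : S) : (p : Plane) ∈ wedge (T j) (T (j + 1)) (T (j + 2)) q ↔
      baryForm (T (j + 1)) (T (j + 2)) (T j) q ≤ baryForm (T (j + 1)) (T (j + 2)) (T j) p ∧
        baryForm (T (j + 2)) (T j) (T (j + 1)) q ≤ baryForm (T (j + 2)) (T j) (T (j + 1)) p := by
    rw [mem_wedge_iff (by rwa [cross_sides T j]), baryForm_sub, baryForm_sub, sub_nonneg,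
      sub_nonneg]
  have hnearest {q p : S} (hqp : R q p) := (isNearest_iff hT).1 (hR.1 q p hqp)
  refine ⟨fun hqp => (hnearest hqp).1, fun hqp => ((hwedge _ _).1 (hnearest hqp).2.1).1,
    fun hqp => ((hwedge _ _).1 (hnearest hqp).2.1).2, fun {q p r} hqp hr hf hg => ?_,
    fun hr hf hg => (hR.2 _ (exists_isNearest hT hr ((hwedge _ _).2 ⟨hf, hg⟩))).exists⟩
  have hle := (hnearest hqp).2.2 r hr ((hwedge _ _).2 ⟨hf, hg⟩)
  rw [baryForm_sub, baryForm_sub, sub_le_sub_iff_right] at hle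
  linarith [baryForm_add_add_eq_zero (T j) (T (j + 1)) (T (j + 2)) p,
    baryForm_add_add_eq_zero (T j) (T (j + 1)) (T (j + 2)) r]

lemma IsTieBreak.rightUnique {N R : S → S → Prop} (hR : IsTieBreak N R) :
    Relator.RightUnique R :=
  fun q p _ hp hp' => (hR.2 q ⟨p, hR.1 q p hp⟩).unique hp hp'

lemma isTieBreak_mostClockwise {N : S → S → Prop}
    (hN : ∀ q, (∃ p, N q p) → ∃ p, MostClockwise N q p) : IsTieBreak N (MostClockwise N) := by
  refine ⟨fun q p hp => hp.1, fun q hq => ?_⟩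
  obtain ⟨p, hp⟩ := hN q hq
  refine ⟨p, hp, fun p' hp' => ?_⟩
  by_contra hne
  have hlt := hp.2 p' hp'.1 hne
  rw [cross_swap, neg_pos] at hlt
  exact hlt.not_gt (hp'.2 p hp.1 (Ne.symm hne))

lemma exists_mostClockwise_isNearest (hT : cross (T 1 - T 0) (T 2 - T 0) < 0) {j : Fin 3} {q : S}
    (hq : ∃ p, IsNearest S T j q p) : ∃ p, MostClockwise (IsNearest S T j) q p := by
  have hTj : cross (T (j + 1) - T j) (T (j + 2) - T j) < 0 := by rwa [cross_sides T j]
  -- The tied points lie on a parallel to the side opposite `T j`, so the most clockwise one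
  -- has the least coordinate at `T (j + 1)`.
  obtain ⟨p, hp, hmin⟩ := Set.exists_min_image {p | IsNearest S T j q p}
    (fun p => baryForm (T (j + 1)) (T (j + 2)) (T j) (p - q)) (Set.toFinite _) hq
  refine ⟨p, hp, fun r hr hrp => ?_⟩
  obtain ⟨hpq, hpw, hpmax⟩ := (isNearest_iff hT.ne).1 hp
  obtain ⟨hrq, hrw, hrmax⟩ := (isNearest_iff hT.ne).1 hr
  have htie := (hrmax p hpq hpw).antisymm (hpmax r hrq hrw)
  have hsum := baryForm_add_add_eq_zero (T j) (T (j + 1)) (T (j + 2))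
  obtain ⟨hB, hC⟩ := (mem_wedge_iff hTj.ne).1 hpw
  have hA : baryForm (T j) (T (j + 1)) (T (j + 2)) (p - q) < 0 := by
    refine lt_of_not_ge fun hA => hpq (Subtype.ext (sub_eq_zero.1 ?_))
    rw [← baryForm_smul_add_baryForm_smul hTj.ne ((p : Plane) - q),
      show baryForm (T (j + 1)) (T (j + 2)) (T j) (p - q) = 0 by linarith [hsum (p - q)],
      show baryForm (T (j + 2)) (T j) (T (j + 1)) (p - q) = 0 by linarith [hsum (p - q)],
      zero_smul, zero_smul, add_zero]
  have hlt : baryForm (T (j + 1)) (T (j + 2)) (T j) (p - q) <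
      baryForm (T (j + 1)) (T (j + 2)) (T j) (r - q) := by
    refine (hmin r hr).lt_of_ne fun heq => hrp (Subtype.ext ?_)
    refine sub_left_injective (b := (q : Plane)) ?_
    exact eq_of_baryForm_eq hTj.ne heq.symm (by linarith [hsum (p - q), hsum (r - q)])
  rw [cross_eq_of_baryForm_eq hTj.ne htie]
  exact mul_pos (mul_pos_of_neg_of_neg hTj hA) (sub_pos.2 hlt)

lemma IsThreeSweepGraph.exists_isPath_of_mem_wedge {G : SimpleGraph S}
    (hG : IsThreeSweepGraph S T G) (hT : cross (T 1 - T 0) (T 2 - T 0) ≠ 0) {s t : S}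
    (hst : (t : Plane) ∈ wedge (T 0) (T 1) (T 2) s) :
    ∃ w : G.Walk s t, w.IsPath ∧
      ((∀ d ∈ w.darts, baryForm (T 0) (T 1) (T 2) (d.snd - d.fst) ≤ 0 ∧
          0 ≤ baryForm (T 2) (T 0) (T 1) (d.snd - d.fst)) ∨
        ∀ d ∈ w.darts, baryForm (T 0) (T 1) (T 2) (d.snd - d.fst) ≤ 0 ∧
          0 ≤ baryForm (T 1) (T 2) (T 0) (d.snd - d.fst)) := by
  obtain ⟨R, hR, rfl⟩ := hG
  set G := SimpleGraph.fromRel fun q p => ∃ j, R j q p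
  set x : S → ℝ := fun p => baryForm (T 1) (T 2) (T 0) p
  set y : S → ℝ := fun p => baryForm (T 2) (T 0) (T 1) p
  set z : S → ℝ := fun p => baryForm (T 0) (T 1) (T 2) p
  have hxyz : IsTriangularCoordinates x y z := isTriangularCoordinates_baryForm S hT
  have ha : IsQuadrantSelector x y (R 0) := (hR 0).isQuadrantSelector hT
  have hb : IsQuadrantSelector y z (R 1) := (hR 1).isQuadrantSelector hT
  have hc : IsQuadrantSelector z x (R 2) := (hR 2).isQuadrantSelector hT
  have hadj {j : Fin 3} {p q : S} (hne : p ≠ q) (h : R j p q ∨ R j q p) : G.Adj p q :=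
    ⟨hne, h.imp (⟨j, ·⟩) (⟨j, ·⟩)⟩
  rw [mem_wedge_iff hT, baryForm_sub, baryForm_sub, sub_nonneg, sub_nonneg] at hst
  simp only [baryForm_sub, sub_nonneg, sub_nonpos]
  refine (reflTransGen_of_mem_quadrant hxyz ha hb hc hst.1 hst.2).elim
    (fun hchain => ?_) fun hchain => ?_
  · obtain ⟨w, hw, hE⟩ := exists_isPath_of_reflTransGen (G := G) (fun p q h => h.elim
      (fun h => hadj (ha.ne h).symm (.inl h)) fun h => hadj (hc.ne h) (.inr h)) hchain
    exact ⟨w, hw, .inl fun d hd => hxyz.le_and_le_of_rel_or_rel ha hc (hE d hd)⟩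
  · obtain ⟨w, hw, hE⟩ := exists_isPath_of_reflTransGen (G := G) (fun p q h => h.elim
      (fun h => hadj (ha.ne h).symm (.inl h)) fun h => hadj (hb.ne h) (.inr h)) hchain
    exact ⟨w, hw, .inr fun d hd =>
      hxyz.swap_left.le_and_le_of_rel_or_rel ha.symm hb.symm (hE d hd)⟩

end Nearest

section SweepGraphs

variable {S : Finset Plane} {α θ : ℝ} {k : ℕ}

lemma rotatedTriangle_one_sub_zero (α θ : ℝ) :
    rotatedTriangle α θ 1 - rotatedTriangle α θ 0 = dir (π / 2 + α - θ) :=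
  sub_zero _

lemma rotatedTriangle_two_sub_zero (α θ : ℝ) :
    rotatedTriangle α θ 2 - rotatedTriangle α θ 0 = dir (π / 2 - α - θ) :=
  sub_zero _

lemma rotatedTriangle_two_sub_one (α θ : ℝ) :
    rotatedTriangle α θ 2 - rotatedTriangle α θ 1 = (2 * sin α) • dir (-θ) := by
  have hB : rotatedTriangle α θ 1 = dir (π / 2 - α - θ + 2 * α) := congrArg dir (by ring)
  have hC : rotatedTriangle α θ 2 = dir (π / 2 - α - θ) := rfl
  rw [hB, hC, dir_sub_dir_add, mul_div_cancel_left₀ α two_ne_zero]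
  congr 2
  ring

lemma cross_rotatedTriangle_neg (hα₀ : 0 < α) (hα : α < π / 2) (θ : ℝ) :
    cross (rotatedTriangle α θ 1 - rotatedTriangle α θ 0)
      (rotatedTriangle α θ 2 - rotatedTriangle α θ 0) < 0 := by
  rw [rotatedTriangle_one_sub_zero, rotatedTriangle_two_sub_zero, cross_dir_dir]
  exact sin_neg_of_neg_of_neg_pi_lt (by linarith) (by linarith)

lemma IsThreeSweepGraph.exists_isAngleMonotoneWalk {G : SimpleGraph S} (hα₀ : 0 < α)
    (hα : α < π / 2) (hG : IsThreeSweepGraph S (rotatedTriangle α θ) G) {s t : S}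
    (hst : InWedge (π / 2 - α - θ) (2 * α) ((t : Plane) - s)) :
    ∃ w : G.Walk s t, w.IsPath ∧ IsAngleMonotoneWalk (π / 2 + α) w := by
  have hABC := cross_rotatedTriangle_neg hα₀ hα θ
  have hAB := rotatedTriangle_one_sub_zero α θ
  have hAC := rotatedTriangle_two_sub_zero α θ
  have hBC := rotatedTriangle_two_sub_one α θ
  set T := rotatedTriangle α θ
  have hBCA : cross (T 2 - T 1) (T 0 - T 1) < 0 := by rwa [cross_sub_sub_rotate]
  have hCAB : cross (T 0 - T 2) (T 1 - T 2) < 0 := by rwa [cross_sub_sub_rotate]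
  have hbase : 0 < 2 * sin α := mul_pos two_pos (sin_pos_of_pos_of_lt_pi hα₀ (by linarith))
  have hγ₀ : 0 < π / 2 + α := by linarith [pi_pos]
  have hγπ : π / 2 + α < π := by linarith
  have hwedge : (t : Plane) ∈ wedge (T 0) (T 1) (T 2) s :=
    (mem_wedge_iff_inWedge (by linarith) (by linarith) one_pos one_pos (by rw [hAC, one_smul])
      (by rw [hAB, one_smul]; congr 1; ring)).2 hst
  obtain ⟨w, hw, hdarts | hdarts⟩ := hG.exists_isPath_of_mem_wedge hABC.ne hwedge
  · refine ⟨w, hw, -θ, fun d hd => ?_⟩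
    rw [inWedge_iff_cross hγ₀ hγπ hbase one_pos hBC (w := T 1 - T 0)
      (by rw [hAB, one_smul]; congr 1; ring), ← baryForm_nonpos_iff hABC,
      ← baryForm_nonneg_iff hCAB]
    exact hdarts d hd
  · refine ⟨w, hw, π / 2 - α - θ, fun d hd => ?_⟩
    have hCB : T 1 - T 2 = (2 * sin α) • dir (π / 2 - α - θ + (π / 2 + α)) := by
      rw [← neg_sub, hBC, ← smul_neg, ← dir_add_pi]
      congr 2; ring
    rw [inWedge_iff_cross hγ₀ hγπ one_pos hbase (u := T 2 - T 0) (by rw [hAC, one_smul]) hCB,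
      ← cross_sub_comm (T 2) (T 0), cross_sub_comm (T 2) (T 1), ← baryForm_nonpos_iff hABC,
      ← baryForm_nonneg_iff hBCA]
    exact (hdarts d hd).symm

lemma IsLayeredSweepGraph.isAngleMonotone {H : SimpleGraph S} (hα₀ : 0 < α) (hα : α < π / 2)
    (hk : π ≤ k * α) (hH : IsLayeredSweepGraph S α k H) : IsAngleMonotone (π / 2 + α) H := by
  obtain ⟨G, hG, rfl⟩ := hH
  intro s t
  obtain ⟨i, hi⟩ := exists_inWedge_of_two_pi_le (k := k) (γ := 2 * α) (by linarith) (π / 2 - α)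
    ((t : Plane) - s)
  obtain ⟨w, hw, φ, hφ⟩ := (hG i).exists_isAngleMonotoneWalk hα₀ hα hi
  refine ⟨w.mapLe (le_iSup G i), hw.mapLe _, φ, ?_⟩
  rw [SimpleGraph.Walk.mapLe, SimpleGraph.Walk.darts_map, List.forall_mem_map]
  exact hφ

lemma IsLayeredSweepGraph.ncard_edgeSet_le {H : SimpleGraph S} (hH : IsLayeredSweepGraph S α k H) :
    H.edgeSet.ncard ≤ 3 * k * S.card := by
  obtain ⟨G, hG, rfl⟩ := hH
  choose R hR hGR using hG
  have hle := ncard_edgeSet_le_of_rightUnique (G := ⨆ i, G i)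
    (R := fun a : Fin k × Fin 3 => R a.1 a.2) (fun a => (hR a.1 a.2).rightUnique) ?_
  · simpa [mul_comm k 3] using hle
  · intro p q hpq
    obtain ⟨i, hi⟩ := SimpleGraph.iSup_adj.1 hpq
    rw [hGR, SimpleGraph.fromRel_adj] at hi
    obtain ⟨-, ⟨j, h⟩ | ⟨j, h⟩⟩ := hi
    · exact ⟨(i, j), .inl h⟩
    · exact ⟨(i, j), .inr h⟩

lemma isLayeredSweepGraph_layeredSweepGraph (hα₀ : 0 < α) (hα : α < π / 2) :
    IsLayeredSweepGraph S α k (layeredSweepGraph S α k) :=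
  ⟨_, fun _ => ⟨_, fun _ => isTieBreak_mostClockwise fun _ =>
    exists_mostClockwise_isNearest (cross_rotatedTriangle_neg hα₀ hα _), rfl⟩, rfl⟩

end SweepGraphs

section ThetaSix

variable {S : Finset Plane} {T : Fin 3 → Plane} {φ γ : ℝ}

/-- Among the points of `S` other than `q` in the cone with apex `q` and direction angles in
`[φ, φ + γ]`, `p` is one of those whose projection to the bisector of the cone is closest to `q`.
This is `IsThetaNearest` for an arbitrary cone. -/
def IsConeNearest (S : Finset Plane) (φ γ : ℝ) (q p : S) : Prop :=
  p ≠ q ∧ InWedge φ γ ((p : Plane) - q) ∧ ∀ r : S, r ≠ q → InWedge φ γ ((r : Plane) - q) →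
    inner ℝ ((p : Plane) - q) (dir (φ + γ / 2)) ≤ inner ℝ ((r : Plane) - q) (dir (φ + γ / 2))

lemma isThetaNearest_eq_isConeNearest (S : Finset Plane) (j : Fin 6) :
    IsThetaNearest S j = IsConeNearest S ((j : ℕ) * (π / 3)) (π / 3) := by
  have hhalf : π / 6 = π / 3 / 2 := by ring
  ext q p
  rw [IsThetaNearest, IsConeNearest, hhalf]

lemma isConeNearest_add_int_mul_two_pi (S : Finset Plane) (φ γ : ℝ) (n : ℤ) :
    IsConeNearest S (φ + n * (2 * π)) γ = IsConeNearest S φ γ := by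
  ext q p
  simp only [IsConeNearest, inWedge_add_int_mul_two_pi, add_right_comm φ, dir_add_int_mul_two_pi]

lemma isNearest_eq_isConeNearest {j : Fin 3} {a : ℝ} (hγ₀ : 0 < γ) (hγπ : γ < π) (ha : 0 < a)
    (hC : T (j + 2) - T j = a • dir φ) (hB : T (j + 1) - T j = a • dir (φ + γ)) :
    IsNearest S T j = IsConeNearest S φ γ := by
  have hT := cross_sub_sub_neg hγ₀ hγπ ha ha hC hB
  rw [cross_sides T j] at hT
  ext q p
  simp only [isNearest_iff hT.ne, IsConeNearest, mem_wedge_iff_inWedge hγ₀ hγπ ha ha hC hB,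
    baryForm_le_baryForm_iff_inner hγ₀ hγπ ha hC hB]

lemma isNearest_rotatedTriangle_pi_div_six (S : Finset Plane) (θ : ℝ) (j : Fin 3) :
    IsNearest S (rotatedTriangle (π / 6) θ) j =
      IsConeNearest S (π / 3 - θ - (j : ℕ) * (2 * π / 3)) (π / 3) := by
  have hAB := rotatedTriangle_one_sub_zero (π / 6) θ
  have hAC := rotatedTriangle_two_sub_zero (π / 6) θ
  have hBC := rotatedTriangle_two_sub_one (π / 6) θ
  set T := rotatedTriangle (π / 6) θ
  suffices h : T (j + 2) - T j = dir (π / 3 - θ - (j : ℕ) * (2 * π / 3)) ∧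
      T (j + 1) - T j = dir (π / 3 - θ - (j : ℕ) * (2 * π / 3) + π / 3) from
    isNearest_eq_isConeNearest (by linarith [pi_pos]) (by linarith [pi_pos]) one_pos
      (by rw [h.1, one_smul]) (by rw [h.2, one_smul])
  have hbase : 2 * sin (π / 6) = 1 := by rw [sin_pi_div_six]; norm_num
  rw [hbase, one_smul] at hBC
  have hBA : T 0 - T 1 = dir (π / 2 + π / 6 - θ - π) := by rw [dir_sub_pi, ← hAB, neg_sub]
  have hCA : T 0 - T 2 = dir (π / 2 - π / 6 - θ - π) := by rw [dir_sub_pi, ← hAC, neg_sub]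
  have hCB : T 1 - T 2 = dir (-θ - π) := by rw [dir_sub_pi, ← hBC, neg_sub]
  fin_cases j
  · refine ⟨hAC.trans (congrArg dir ?_), hAB.trans (congrArg dir ?_)⟩ <;> norm_num <;> ring
  · refine ⟨hBA.trans (congrArg dir ?_), hBC.trans (congrArg dir ?_)⟩ <;> norm_num <;> ring
  · refine ⟨hCB.trans (congrArg dir ?_), hCA.trans (congrArg dir ?_)⟩ <;> norm_num <;> ring

lemma isNearest_layerTriangle_pi_div_six (S : Finset Plane) {i m : Fin 6} {j : Fin 3}
    (hm : (m : ℤ) ≡ 1 - i - 2 * j [ZMOD 6]) :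
    IsNearest S (layerTriangle (π / 6) 6 i) j = IsThetaNearest S m := by
  -- The wedge at corner `j` of layer `i` starts at the direction angle `(1 - i - 2 * j) * (π / 3)`.
  obtain ⟨n, hn⟩ := hm.dvd
  have hn' : (m : ℝ) = 1 - i - 2 * j - 6 * n := by
    have hmz : (m : ℤ) = 1 - i - 2 * j - 6 * n := by linarith
    exact_mod_cast hmz
  rw [layerTriangle, isNearest_rotatedTriangle_pi_div_six, isThetaNearest_eq_isConeNearest,
    ← isConeNearest_add_int_mul_two_pi S ((m : ℕ) * (π / 3)) _ n, hn']
  congr 1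
  push_cast
  ring

lemma layeredSweepGraph_pi_div_six (S : Finset Plane) :
    layeredSweepGraph S (π / 6) 6 = thetaSixGraph S := by
  have hcone : ∀ (i : Fin 6) (j : Fin 3), ∃ m : Fin 6, (m : ℤ) ≡ 1 - i - 2 * j [ZMOD 6] := by
    decide
  have hcorner : ∀ m : Fin 6, ∃ i : Fin 6, (m : ℤ) ≡ 1 - i - 2 * (0 : Fin 3) [ZMOD 6] := by
    decide
  have hR (q p : S) :
      (∃ (i : Fin 6) (j : Fin 3), MostClockwise (IsNearest S (layerTriangle (π / 6) 6 i) j) q p) ↔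
        ∃ m : Fin 6, MostClockwise (IsThetaNearest S m) q p := by
    constructor
    · rintro ⟨i, j, h⟩
      obtain ⟨m, hm⟩ := hcone i j
      exact ⟨m, by rwa [isNearest_layerTriangle_pi_div_six S hm] at h⟩
    · rintro ⟨m, h⟩
      obtain ⟨i, hi⟩ := hcorner m
      exact ⟨i, 0, by rwa [isNearest_layerTriangle_pi_div_six S hi]⟩
  ext q p
  simp only [layeredSweepGraph, threeSweepGraph, thetaSixGraph, SimpleGraph.iSup_adj,
    SimpleGraph.fromRel_adj, exists_and_left, exists_or, hR]

end ThetaSix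

theorem mainTheorem2_general {α : ℝ} {k : ℕ} (hα₀ : 0 < α) (hα : α < π / 2) (hk : (k : ℝ) = π / α)
    (S : Finset Plane) :
    (IsAngleMonotone (π / 2 + α) (layeredSweepGraph S α k) ∧
        ((layeredSweepGraph S α k).edgeSet.ncard : ℝ) ≤ 3 * π * (S.card / α)) ∧
      (∀ H : SimpleGraph S, IsLayeredSweepGraph S α k H →
        IsAngleMonotone (π / 2 + α) H ∧ (H.edgeSet.ncard : ℝ) ≤ 3 * π * (S.card / α)) ∧
      (α = π / 6 → layeredSweepGraph S α k = thetaSixGraph S) := by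
  have hlayered (H : SimpleGraph S) (hH : IsLayeredSweepGraph S α k H) :
      IsAngleMonotone (π / 2 + α) H ∧ (H.edgeSet.ncard : ℝ) ≤ 3 * π * (S.card / α) := by
    refine ⟨hH.isAngleMonotone hα₀ hα (by rw [hk, div_mul_cancel₀ _ hα₀.ne']), ?_⟩
    calc (H.edgeSet.ncard : ℝ) ≤ 3 * k * S.card := mod_cast hH.ncard_edgeSet_le
      _ = 3 * π * (S.card / α) := by rw [hk]; ring
  refine ⟨hlayered _ (isLayeredSweepGraph_layeredSweepGraph hα₀ hα), hlayered, ?_⟩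
  rintro rfl
  obtain rfl : k = 6 := by
    rw [div_div_cancel₀ pi_ne_zero] at hk
    exact_mod_cast hk
  exact layeredSweepGraph_pi_div_six S

theorem mainTheorem2 :
    ∃ c : ℝ, 0 < c ∧ ∀ (α : ℝ) (k : ℕ), 0 < α → α < Real.pi / 4 → (k : ℝ) = Real.pi / α →
      ∀ S : Finset Plane,
        (IsAngleMonotone (Real.pi / 2 + α) (layeredSweepGraph S α k) ∧
          ((layeredSweepGraph S α k).edgeSet.ncard : ℝ) ≤ c * (S.card / α)) ∧
        (∀ H : SimpleGraph S, IsLayeredSweepGraph S α k H →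
          IsAngleMonotone (Real.pi / 2 + α) H ∧
            (H.edgeSet.ncard : ℝ) ≤ c * (S.card / α)) ∧
        (α = Real.pi / 6 → layeredSweepGraph S α k = thetaSixGraph S) :=
  ⟨3 * π, by positivity, fun _ _ hα₀ hα hk S =>
    mainTheorem2_general hα₀ (by linarith [pi_pos]) hk S⟩
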